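/- Let $V$ be a $3$-dimensional complex vector space with a Hermitian form $\langle\cdot,\cdot\rangle$ (linear in the first argument) of signature $++-$. The signature $\sigma p\in\{-1,0,1\}$ of a point $p\in\mathbb PV$ is the sign of $\langle p,p\rangle$, and $p$ is negative, isotropic or positive accordingly. For nonisotropic points $p,q$ put $$\mathrm{ta}(p,q)=\frac{\langle p,q\rangle\langle q,p\rangle}{\langle p,p\rangle\langle q,q\rangle},$$ and for a unit complex number $\alpha$ let $R^p_\alpha\in\mathrm{SU}(2,1)$ be the map $$R^p_\alpha:x\mapsto(\alpha^{-2}-\alpha)\frac{\langle x,p\rangle}{\langle p,p\rangle}\,p+\alpha x .$$ A complex line $\mathbb PW$ ($W\subset V$, $\dim_{\mathbb C}W=2$) is hyperbolic, spherical or Euclidean if the form restricted to $W$ has signature $+-$, $++$ or $+0$, respectively. The fixed points of $I\in\mathrm{SU}(2,1)$ are its eigenvectors, regarded as points of $\mathbb PV$. Call $I$ elliptic if it has a negative fixed point, and regular elliptic if moreover it has three distinct eigenvalues. Call $I$ parabolic (respectively loxodromic) if it has no negative fixed point and exactly one (respectively exactly two) isotropic fixed points. Call $I$ ellipto-parabolic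 if it is parabolic and $\delta I$ is not unipotent for any cube root of unity $\delta$. Let $\alpha_1,\alpha_2$ be unit complex numbers with $\alpha_1^3\ne1\ne\alpha_2^3$. Let $p_1,p_2\in\mathbb PV$ be distinct nonisotropic points with $\langle p_1,p_2\rangle\ne0$ such that the complex line $L$ through $p_1$ and $p_2$ is not Euclidean. Put $\sigma_i=\sigma p_i$, $\chi_i=\operatorname{Im}\bigl(\alpha_i/(\alpha_i^{-2}-\alpha_i)\bigr)$ and $$k_1=\frac{1+4\chi_1\chi_2+\sigma_1\sigma_2\sqrt{(1+4\chi_1^2)(1+4\chi_2^2)}}{2}.$$ Then $R=R^{p_2}_{\alpha_2}R^{p_1}_{\alpha_1}$ is * regular elliptic if and only if either $0<\mathrm{ta}(p_1,p_2)<1$, or $L$ is hyperbolic and $\sigma_1\sigma_2\,\mathrm{ta}(p_1,p_2)<\sigma_1\sigma_2k_1$; * ellipto-parabolic if and only if $L$ is hyperbolic and $\mathrm{ta}(p_1,p_2)=k_1$; * loxodromic if and only if $L$ is hyperbolic and $\sigma_1\sigma_2\,\mathrm{ta}(p_1,p_2)>\sigma_1\sigma_2k_1$. -/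

import Mathlib

open scoped LinearAlgebra.Projectivization ComplexConjugate

namespace ComplexHyperbolic

section

variable {V : Type*} [AddCommGroup V] [Module ℂ V]

/-- The form `h x y = ⟨x, y⟩`, linear in `x` and conjugate-linear in `y`, is Hermitian of
signature `++-` (in particular `V` has dimension three). -/
structure IsHermitianPPM (h : V →ₗ[ℂ] V →ₗ⋆[ℂ] ℂ) : Prop where
  conj_symm : ∀ x y, conj (h x y) = h y x
  exists_basis : ∃ b : Module.Basis (Fin 3) ℂ V,
    ∀ i j, h (b i) (b j) = if i = j then ![1, 1, -1] i else 0

/-- The real number `⟨v, v⟩` for the chosen representative `v` of the point `p`;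
only its sign depends on `p` alone. -/
noncomputable def normSq (h : V →ₗ[ℂ] V →ₗ⋆[ℂ] ℂ) (p : ℙ ℂ V) : ℝ := (h p.rep p.rep).re

def IsNegative (h : V →ₗ[ℂ] V →ₗ⋆[ℂ] ℂ) (p : ℙ ℂ V) : Prop := normSq h p < 0

def IsIsotropic (h : V →ₗ[ℂ] V →ₗ⋆[ℂ] ℂ) (p : ℙ ℂ V) : Prop := normSq h p = 0

/-- The signature `σ p` of a point: `-1`, `0`, `1` for negative, isotropic, positive `p`. -/
noncomputable def signature (h : V →ₗ[ℂ] V →ₗ⋆[ℂ] ℂ) (p : ℙ ℂ V) : ℝ := Real.sign (normSq h p)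

def AreOrthogonal (h : V →ₗ[ℂ] V →ₗ⋆[ℂ] ℂ) (p q : ℙ ℂ V) : Prop := h p.rep q.rep = 0

/-- The tance `⟨p, q⟩⟨q, p⟩ / (⟨p, p⟩⟨q, q⟩)`, which is a real number
(see `coe_tance`) independent of representatives (see `tance_mk`). -/
noncomputable def tance (h : V →ₗ[ℂ] V →ₗ⋆[ℂ] ℂ) (p q : ℙ ℂ V) : ℝ :=
  (h p.rep q.rep * h q.rep p.rep / (h p.rep p.rep * h q.rep q.rep)).re

/-- The complex line `L(p, q)` through `p ≠ q`, as a two-dimensional subspace of `V`. -/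
noncomputable def line (p q : ℙ ℂ V) : Submodule ℂ V := p.submodule ⊔ q.submodule

/-- The form restricted to the two-dimensional subspace `W` is `diag(a, b)` in some basis. -/
def IsDiagOn (h : V →ₗ[ℂ] V →ₗ⋆[ℂ] ℂ) (W : Submodule ℂ V) (a b : ℂ) : Prop :=
  ∃ x y : V, LinearIndependent ℂ ![x, y] ∧ W = Submodule.span ℂ {x, y} ∧
    h x x = a ∧ h y y = b ∧ h x y = 0 ∧ h y x = 0

/-- Signature `+-`. -/
def IsHyperbolicLine (h : V →ₗ[ℂ] V →ₗ⋆[ℂ] ℂ) (W : Submodule ℂ V) : Prop := IsDiagOn h W 1 (-1)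

/-- Signature `+0`. -/
def IsEuclideanLine (h : V →ₗ[ℂ] V →ₗ⋆[ℂ] ℂ) (W : Submodule ℂ V) : Prop := IsDiagOn h W 1 0

/-- The special elliptic isometry with centre `p` and parameter `α`,
`x ↦ (α⁻² - α) (⟨x, p⟩ / ⟨p, p⟩) p + α x`. -/
noncomputable def specialElliptic (h : V →ₗ[ℂ] V →ₗ⋆[ℂ] ℂ) (p : ℙ ℂ V) (α : ℂ) :
    Module.End ℂ V where
  toFun x := ((α⁻¹ ^ 2 - α) * (h x p.rep / h p.rep p.rep)) • p.rep + α • x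
  map_add' x y := by
    simp only [map_add, LinearMap.add_apply, smul_add, add_div, mul_add, add_smul]
    abel
  map_smul' c x := by
    simp only [map_smul, LinearMap.smul_apply, smul_eq_mul, RingHom.id_apply, smul_add, smul_smul]
    congr 2 <;> ring

/-- Fixed points of an isometry in the projective plane are its eigenvectors. -/
def IsFixedPoint (I : Module.End ℂ V) (p : ℙ ℂ V) : Prop := ∃ μ : ℂ, I p.rep = μ • p.rep

def isotropicFixedPoints (h : V →ₗ[ℂ] V →ₗ⋆[ℂ] ℂ) (I : Module.End ℂ V) : Set (ℙ ℂ V) :=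
  {p | IsIsotropic h p ∧ IsFixedPoint I p}

def IsElliptic (h : V →ₗ[ℂ] V →ₗ⋆[ℂ] ℂ) (I : Module.End ℂ V) : Prop :=
  ∃ p : ℙ ℂ V, IsNegative h p ∧ IsFixedPoint I p

def IsParabolic (h : V →ₗ[ℂ] V →ₗ⋆[ℂ] ℂ) (I : Module.End ℂ V) : Prop :=
  ¬ IsElliptic h I ∧ (isotropicFixedPoints h I).ncard = 1

def IsLoxodromic (h : V →ₗ[ℂ] V →ₗ⋆[ℂ] ℂ) (I : Module.End ℂ V) : Prop :=
  ¬ IsElliptic h I ∧ (isotropicFixedPoints h I).ncard = 2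

/-- Elliptic with three pairwise distinct eigenvalues. -/
def IsRegularElliptic (h : V →ₗ[ℂ] V →ₗ⋆[ℂ] ℂ) (I : Module.End ℂ V) : Prop :=
  IsElliptic h I ∧ ∃ μ : Fin 3 → ℂ, Function.Injective μ ∧ ∀ i, Module.End.HasEigenvalue I (μ i)

/-- One of the lifts `δ I`, `δ³ = 1`, to `SU(2,1)` of the class of `I ∈ SU(2,1)` in `PU(2,1)`
is unipotent. -/
def HasUnipotentLift (I : Module.End ℂ V) : Prop :=
  ∃ δ : ℂ, δ ^ 3 = 1 ∧ IsNilpotent (δ • I - 1)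

/-- Parabolic and not parabolic unipotent. -/
def IsElliptoParabolic (h : V →ₗ[ℂ] V →ₗ⋆[ℂ] ℂ) (I : Module.End ℂ V) : Prop :=
  IsParabolic h I ∧ ¬ HasUnipotentLift I

/-- `χ = Im (α / (α⁻² - α))`. -/
noncomputable def chi (α : ℂ) : ℝ := (α / (α⁻¹ ^ 2 - α)).im

/-- The constant `k₁` for parameters `α₁, α₂` and signs `σ₁, σ₂`. -/
noncomputable def kOne (α₁ α₂ : ℂ) (σ₁ σ₂ : ℝ) : ℝ :=
  (1 + 4 * chi α₁ * chi α₂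
    + σ₁ * σ₂ * Real.sqrt ((1 + 4 * chi α₁ ^ 2) * (1 + 4 * chi α₂ ^ 2))) / 2

theorem coe_tance {h : V →ₗ[ℂ] V →ₗ⋆[ℂ] ℂ} (hh : IsHermitianPPM h) (p q : ℙ ℂ V) :
    (tance h p q : ℂ) =
      h p.rep q.rep * h q.rep p.rep / (h p.rep p.rep * h q.rep q.rep) := by
  unfold tance
  apply Complex.conj_eq_iff_re.mp
  simp only [map_div₀, map_mul, hh.conj_symm]
  ring

theorem tance_mk (h : V →ₗ[ℂ] V →ₗ⋆[ℂ] ℂ) (v w : V) (hv : v ≠ 0) (hw : w ≠ 0) :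
    tance h (Projectivization.mk ℂ v hv) (Projectivization.mk ℂ w hw) =
      (h v w * h w v / (h v v * h w w)).re := by
  obtain ⟨a, ha⟩ := Projectivization.exists_smul_eq_mk_rep ℂ v hv
  obtain ⟨b, hb⟩ := Projectivization.exists_smul_eq_mk_rep ℂ w hw
  have ha0 : (a : ℂ) ≠ 0 := a.ne_zero
  have hb0 : (b : ℂ) ≠ 0 := b.ne_zero
  have ha1 : conj (a : ℂ) ≠ 0 := (map_ne_zero _).2 ha0
  have hb1 : conj (b : ℂ) ≠ 0 := (map_ne_zero _).2 hb0
  unfold tance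
  rw [← ha, ← hb]
  simp only [Units.smul_def, map_smul, LinearMap.smul_apply, map_smulₛₗ, smul_eq_mul]
  congr 1
  rw [← mul_div_mul_left (h v w * h w v) (h v v * h w w)
    (mul_ne_zero (mul_ne_zero ha0 hb0) (mul_ne_zero ha1 hb1))]
  congr 1 <;> ring

theorem specialElliptic_mk (h : V →ₗ[ℂ] V →ₗ⋆[ℂ] ℂ) (v : V) (hv : v ≠ 0) (α : ℂ) (x : V) :
    specialElliptic h (Projectivization.mk ℂ v hv) α x =
      ((α⁻¹ ^ 2 - α) * (h x v / h v v)) • v + α • x := by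
  obtain ⟨a, ha⟩ := Projectivization.exists_smul_eq_mk_rep ℂ v hv
  have ha0 : (a : ℂ) ≠ 0 := a.ne_zero
  have ha1 : conj (a : ℂ) ≠ 0 := (map_ne_zero _).2 ha0
  simp only [specialElliptic, LinearMap.coe_mk, AddHom.coe_mk]
  rw [← ha]
  simp only [Units.smul_def, map_smul, LinearMap.smul_apply, map_smulₛₗ, smul_eq_mul, smul_smul]
  congr 2
  rw [← mul_div_mul_left (h x v) (h v v) (mul_ne_zero ha0 ha1)]
  field_simp

end

end ComplexHyperbolic

namespace ComplexHyperbolic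

/-! ### Hermitian forms of signature `++-` and frames adapted to a complex line -/

section Form

variable {V : Type*} [AddCommGroup V] [Module ℂ V] {h : V →ₗ[ℂ] V →ₗ⋆[ℂ] ℂ}

/-! Put `Aᵢ = αᵢ / (αᵢ⁻² - αᵢ)`. Since `αᵢ` is a unit, `Aᵢ = -1/2 + iχᵢ`, hence `1 + Aᵢ = -conj Aᵢ`.
Up to a nonzero scalar, `R` preserves `L` and its orthogonal complement. It is the scalar `A₁A₂` on
the normal, and on `L` it has characteristic polynomial `z² - Tz + Δ` with real coefficients `T = τ
- 1/2 - 2χ₁χ₂`, `Δ = |A₁A₂|²`, where `τ` is the tance (`IsLineFrame.prod_apply`, `lineChar_eq`). At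
`A₁A₂` this polynomial equals `A₁A₂(1 - τ)`, which is nonzero because `L` is not Euclidean.
Everything therefore depends on the discriminant `D = T² - 4Δ`.

If `D < 0`, there are three distinct eigenvalues and a negative fixed point: the normal when `L` is
spherical, and one of the two eigenvectors on `L` when `L` is hyperbolic, since their norms then
have opposite signs. If `D ≥ 0` and `L` is hyperbolic, the normal is positive and the eigenvectors
on `L`, having real normalized eigenvalues, are isotropic (`IsLineFrame.lineEigenvector_isotropic`).
So there is one isotropic fixed point for `D = 0` and there are two for `D > 0`.

The sign of the Gram determinant `ab(1 - τ)` gives the type of `L`, and `τab = |⟨u,v⟩|² > 0`. Thus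
spherical means `0 < τ < 1`, where `D < 0` automatically (`neg_discr_eq`). On a hyperbolic line, `D`
is a quadratic in `τ` whose roots are `k₁` and the same expression with the square root negated; the
factor of the second root has a constant sign (`exists_discr_factor`). -/

theorem IsHermitianPPM.coe_re (hh : IsHermitianPPM h) (x : V) : (((h x x).re : ℝ) : ℂ) = h x x :=
  Complex.conj_eq_iff_re.mp (hh.conj_symm x x)

theorem IsHermitianPPM.eq_zero_symm (hh : IsHermitianPPM h) {x y : V} (hxy : h x y = 0) :
    h y x = 0 := by
  rw [← hh.conj_symm, hxy, map_zero]

theorem IsHermitianPPM.exists_coords (hh : IsHermitianPPM h) :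
    ∃ b : Module.Basis (Fin 3) ℂ V, ∀ x y,
      h x y = b.repr x 0 * conj (b.repr y 0) + b.repr x 1 * conj (b.repr y 1)
        - b.repr x 2 * conj (b.repr y 2) := by
  obtain ⟨b, hb⟩ := hh.exists_basis
  refine ⟨b, fun x y => ?_⟩
  conv_lhs => rw [← b.sum_repr x, ← b.sum_repr y]
  simp only [Fin.sum_univ_three, map_add, LinearMap.add_apply, map_smul, LinearMap.smul_apply,
    map_smulₛₗ, smul_eq_mul, hb]
  simp
  ring

/-- The orthogonal complement of a negative vector is positive definite. -/
theorem IsHermitianPPM.pos_of_orthogonal_neg (hh : IsHermitianPPM h) {x y : V}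
    (hx : (h x x).re < 0) (hy : y ≠ 0) (hyx : h y x = 0) : 0 < (h y y).re := by
  obtain ⟨b, hb⟩ := hh.exists_coords
  rw [hb] at hx hyx ⊢
  have hy' : b.repr y ≠ 0 := by simpa using hy
  generalize hX : b.repr x = X at *
  generalize hY : b.repr y = Y at *
  have key : ∀ z : ℂ, (z * conj z).re = Complex.normSq z := fun z => by
    rw [Complex.mul_conj, Complex.ofReal_re]
  simp only [Complex.add_re, Complex.sub_re, key] at hx ⊢
  have h1 : Complex.normSq (Y 0 * conj (X 0) + Y 1 * conj (X 1))
      = Complex.normSq (Y 2) * Complex.normSq (X 2) := by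
    rw [sub_eq_zero.mp hyx, Complex.normSq_mul, Complex.normSq_conj]
  have h2 : Complex.normSq (Y 0 * conj (X 0) + Y 1 * conj (X 1)) ≤
      (Complex.normSq (Y 0) + Complex.normSq (Y 1)) *
        (Complex.normSq (X 0) + Complex.normSq (X 1)) := by
    -- Lagrange's identity: this term is the defect in the Cauchy–Schwarz inequality.
    have h3 := Complex.normSq_nonneg (Y 0 * X 1 - Y 1 * X 0)
    simp only [Complex.normSq_apply, Complex.add_re, Complex.add_im, Complex.mul_re,
      Complex.mul_im, Complex.conj_re, Complex.conj_im, Complex.sub_re, Complex.sub_im] at h3 ⊢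
    linarith
  rw [h1] at h2
  have n0 := Complex.normSq_nonneg (X 0)
  have n1 := Complex.normSq_nonneg (X 1)
  have m0 := Complex.normSq_nonneg (Y 0)
  have m1 := Complex.normSq_nonneg (Y 1)
  have m2 := Complex.normSq_nonneg (Y 2)
  have hp : 0 < Complex.normSq (X 2) := by linarith
  have hpos : 0 < Complex.normSq (Y 0) + Complex.normSq (Y 1) := by
    rcases (add_nonneg m0 m1).lt_or_eq with hlt | heq
    · exact hlt
    · exfalso
      apply hy'
      rw [← heq, zero_mul] at h2
      have e2 : Complex.normSq (Y 2) = 0 := by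
        have : Complex.normSq (Y 2) * Complex.normSq (X 2) = 0 :=
          le_antisymm h2 (mul_nonneg m2 hp.le)
        exact (mul_eq_zero.mp this).resolve_right hp.ne'
      have e0 : Complex.normSq (Y 0) = 0 := by linarith
      have e1 : Complex.normSq (Y 1) = 0 := by linarith
      ext i
      fin_cases i
      · exact Complex.normSq_eq_zero.mp e0
      · exact Complex.normSq_eq_zero.mp e1
      · exact Complex.normSq_eq_zero.mp e2
  have h4 : Complex.normSq (Y 2) * Complex.normSq (X 2) <
      (Complex.normSq (Y 0) + Complex.normSq (Y 1)) * Complex.normSq (X 2) :=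
    h2.trans_lt (mul_lt_mul_of_pos_left (by linarith) hpos)
  have := lt_of_mul_lt_mul_right h4 hp.le
  linarith

theorem IsHermitianPPM.exists_neg (hh : IsHermitianPPM h) : ∃ x, (h x x).re < 0 := by
  obtain ⟨b, hb⟩ := hh.exists_basis
  exact ⟨b 2, by simp [hb]⟩

theorem IsHermitianPPM.finrank_eq (hh : IsHermitianPPM h) : Module.finrank ℂ V = 3 := by
  obtain ⟨b, -⟩ := hh.exists_basis
  simpa using Module.finrank_eq_card_basis b

theorem IsHermitianPPM.exists_orthogonal (hh : IsHermitianPPM h) (u v : V) :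
    ∃ n : V, n ≠ 0 ∧ h n u = 0 ∧ h n v = 0 := by
  have hfin : FiniteDimensional ℂ V := Module.finite_of_finrank_pos (by rw [hh.finrank_eq]; simp)
  have hker : LinearMap.ker ((h.flip u).prod (h.flip v)) ≠ ⊥ :=
    LinearMap.ker_ne_bot_of_finrank_lt (by rw [hh.finrank_eq]; simp)
  obtain ⟨n, hn, hn0⟩ := Submodule.exists_mem_ne_zero_of_ne_bot hker
  have := Prod.mk_eq_zero.mp (LinearMap.mem_ker.mp hn)
  exact ⟨n, hn0, by simpa using this⟩

/-- A basis `u, v, n` of `V` in which `u`, `v` are nonisotropic with tance `τ` and span a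
nondegenerate complex line, while `n` is orthogonal to that line. -/
structure IsLineFrame (h : V →ₗ[ℂ] V →ₗ⋆[ℂ] ℂ) (u v n : V) (a b τ : ℝ) : Prop where
  hermitian : IsHermitianPPM h
  self_left : h u u = a
  self_right : h v v = b
  left_ne : a ≠ 0
  right_ne : b ≠ 0
  mul_eq : h u v * h v u = τ * a * b
  tance_ne_zero : τ ≠ 0
  tance_ne_one : τ ≠ 1
  normal_left : h n u = 0
  normal_right : h n v = 0
  exists_eq : ∀ x : V, ∃ s t r : ℂ, x = s • u + t • v + r • n
  eq_zero : ∀ s t r : ℂ, s • u + t • v + r • n = 0 → s = 0 ∧ t = 0 ∧ r = 0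

/-- One Gram–Schmidt step. It diagonalizes the form on the line as `a`, `b(1 - τ)`, so the sign of
`ab(1 - τ)` separates hyperbolic from spherical lines. -/
theorem self_sub_proj (hh : IsHermitianPPM h) {u v : V} {a b τ : ℝ} (hu : h u u = a)
    (hv : h v v = b) (ha : a ≠ 0) (hc : h u v * h v u = τ * a * b) :
    h (v - (h v u / a) • u) (v - (h v u / a) • u) = (b * (1 - τ) : ℝ) ∧
      h (v - (h v u / a) • u) u = 0 := by
  have ha' : (a : ℂ) ≠ 0 := by exact_mod_cast ha
  constructor
  · simp only [map_sub, LinearMap.sub_apply, map_smul, LinearMap.smul_apply, map_smulₛₗ,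
      smul_eq_mul, map_div₀, hh.conj_symm, Complex.conj_ofReal, hu, hv]
    push_cast
    field_simp
    linear_combination (-1 : ℂ) * hc
  · simp only [map_sub, LinearMap.sub_apply, map_smul, LinearMap.smul_apply, smul_eq_mul, hu]
    field_simp
    ring

theorem exists_isLineFrame (hh : IsHermitianPPM h) {u v : V} {a b τ : ℝ} (hu : h u u = a)
    (hv : h v v = b) (ha : a ≠ 0) (hb : b ≠ 0) (hc : h u v * h v u = τ * a * b) (h0 : τ ≠ 0)
    (h1 : τ ≠ 1) : ∃ n, IsLineFrame h u v n a b τ := by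
  obtain ⟨n, hn, hnu, hnv⟩ := hh.exists_orthogonal u v
  have ha' : (a : ℂ) ≠ 0 := by exact_mod_cast ha
  have hb' : (b : ℂ) ≠ 0 := by exact_mod_cast hb
  have h1' : (1 - τ : ℂ) ≠ 0 := by
    rw [sub_ne_zero]; exact_mod_cast h1.symm
  have hzero : ∀ s t r : ℂ, s • u + t • v + r • n = 0 → s = 0 ∧ t = 0 ∧ r = 0 := by
    intro s t r hz
    have e1 : h (s • u + t • v + r • n) u = 0 := by rw [hz]; simp
    have e2 : h (s • u + t • v + r • n) v = 0 := by rw [hz]; simp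
    simp only [map_add, map_smul, LinearMap.add_apply, LinearMap.smul_apply, smul_eq_mul, hu, hv,
      hnu, hnv, mul_zero, add_zero] at e1 e2
    -- Eliminating `s` from the two pairings leaves `t` times the Gram determinant.
    have ht : t = 0 := by
      have : t * (a * b * (1 - τ)) = 0 := by
        linear_combination (a : ℂ) * e2 - h u v * e1 + t * hc
      exact (mul_eq_zero.mp this).resolve_right (mul_ne_zero (mul_ne_zero ha' hb') h1')
    subst ht
    have hs : s = 0 := by simpa [ha] using e1
    subst hs
    simpa [hn] using hz
  refine ⟨n, hh, hu, hv, ha, hb, hc, h0, h1, hnu, hnv, fun x => ?_, hzero⟩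
  have hli : LinearIndependent ℂ ![u, v, n] := by
    rw [Fintype.linearIndependent_iff]
    intro g hg
    rw [Fin.sum_univ_three] at hg
    obtain ⟨e0, e1, e2⟩ := hzero (g 0) (g 1) (g 2) hg
    intro i
    fin_cases i
    exacts [e0, e1, e2]
  let B := basisOfLinearIndependentOfCardEqFinrank hli (by rw [hh.finrank_eq]; simp)
  refine ⟨B.repr x 0, B.repr x 1, B.repr x 2, ?_⟩
  conv_lhs => rw [← B.sum_repr x, Fin.sum_univ_three]
  simp [B]

namespace IsLineFrame

variable {u v n : V} {a b τ : ℝ}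

theorem normal_ne_zero (F : IsLineFrame h u v n a b τ) : n ≠ 0 := by
  rintro rfl
  simpa using F.eq_zero 0 0 1 (by simp)

/-- The normal vector of a hyperbolic line is positive. -/
theorem normal_pos (F : IsLineFrame h u v n a b τ) (hneg : a * b * (1 - τ) < 0) :
    0 < (h n n).re := by
  have hh := F.hermitian
  by_cases ha : a < 0
  · exact hh.pos_of_orthogonal_neg (x := u) (by simpa [F.self_left]) F.normal_ne_zero F.normal_left
  · have ha : 0 < a := lt_of_le_of_ne (not_lt.mp ha) F.left_ne.symm
    obtain ⟨hw, -⟩ := self_sub_proj hh F.self_left F.self_right F.left_ne F.mul_eq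
    refine hh.pos_of_orthogonal_neg (x := v - (h v u / a) • u) ?_ F.normal_ne_zero ?_
    · rw [hw, Complex.ofReal_re]
      rw [mul_assoc] at hneg
      by_contra hcon
      exact absurd hneg (not_lt.mpr (mul_nonneg ha.le (not_lt.mp hcon)))
    · simp [F.normal_left, F.normal_right]

/-- Were `a` negative, the complement of `u` would be positive definite, forcing `b(1 - τ) > 0` and
a negative Gram determinant. -/
theorem left_pos (F : IsLineFrame h u v n a b τ) (hpos : 0 < a * b * (1 - τ)) : 0 < a := by
  have hh := F.hermitian
  by_contra hcon
  have ha : a < 0 := lt_of_le_of_ne (not_lt.mp hcon) F.left_ne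
  obtain ⟨hw, hwu⟩ := self_sub_proj hh F.self_left F.self_right F.left_ne F.mul_eq
  have := hh.pos_of_orthogonal_neg (x := u) (y := v - (h v u / a) • u) (by simpa [F.self_left])
    (fun h0 => by
      have := F.eq_zero (-(h v u / a)) 1 0 (by rw [← h0]; module)
      simp at this) hwu
  rw [hw, Complex.ofReal_re] at this
  rw [mul_assoc] at hpos
  exact absurd hpos (not_lt.mpr (mul_nonpos_of_nonpos_of_nonneg ha.le this.le))

/-- The normal vector of a spherical line is negative. -/
theorem normal_neg (F : IsLineFrame h u v n a b τ) (hpos : 0 < a * b * (1 - τ)) :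
    (h n n).re < 0 := by
  have hh := F.hermitian
  have ha := F.left_pos hpos
  obtain ⟨hw, hwu⟩ := self_sub_proj hh F.self_left F.self_right F.left_ne F.mul_eq
  have hb : 0 < b * (1 - τ) := by
    rw [mul_assoc] at hpos
    exact (mul_pos_iff_of_pos_left ha).mp hpos
  set w := v - (h v u / a) • u with hwdef
  -- If `n` were not negative, the form would be nonnegative in the orthogonal basis `u, w, n`, yet
  -- a negative vector exists.
  by_contra hcon
  obtain ⟨x, hx⟩ := hh.exists_neg
  obtain ⟨s, t, r, rfl⟩ := F.exists_eq x
  have hx' : s • u + t • v + r • n = (s + t * (h v u / a)) • u + t • w + r • n := by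
    rw [hwdef]; module
  have hnw : h n w = 0 := by simp [hwdef, F.normal_left, F.normal_right]
  rw [hx'] at hx
  generalize s + t * (h v u / a) = s' at hx
  have e : h (s' • u + t • w + r • n) (s' • u + t • w + r • n) =
      (Complex.normSq s' * a + Complex.normSq t * (b * (1 - τ))
        + Complex.normSq r * (h n n).re : ℝ) := by
    simp only [map_add, map_smul, LinearMap.add_apply, LinearMap.smul_apply, smul_eq_mul,
      map_smulₛₗ, F.self_left, hw, hwu, hh.eq_zero_symm hwu, F.normal_left, hnw,
      hh.eq_zero_symm hnw, hh.eq_zero_symm F.normal_left]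
    push_cast
    rw [hh.coe_re, ← Complex.mul_conj, ← Complex.mul_conj, ← Complex.mul_conj]
    ring
  rw [e, Complex.ofReal_re] at hx
  have p1 := mul_nonneg (Complex.normSq_nonneg s') ha.le
  have p2 := mul_nonneg (Complex.normSq_nonneg t) hb.le
  have p3 := mul_nonneg (Complex.normSq_nonneg r) (not_lt.mp hcon)
  linarith

end IsLineFrame

end Form

end ComplexHyperbolic
namespace ComplexHyperbolic

/-! ### The type of a complex line read off from its Gram determinant -/

section Lines

variable {V : Type*} [AddCommGroup V] [Module ℂ V] {h : V →ₗ[ℂ] V →ₗ⋆[ℂ] ℂ}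

theorem linearIndependent_smul_pair {x y : V} {s t : ℂ} (hs : s ≠ 0) (ht : t ≠ 0)
    (hxy : LinearIndependent ℂ ![x, y]) : LinearIndependent ℂ ![s • x, t • y] := by
  rw [LinearIndependent.pair_iff] at hxy ⊢
  intro c d hcd
  rw [smul_smul, smul_smul] at hcd
  simpa [hs, ht] using hxy _ _ hcd

theorem span_smul_pair {x y : V} {s t : ℂ} (hs : s ≠ 0) (ht : t ≠ 0) :
    Submodule.span ℂ {s • x, t • y} = Submodule.span ℂ {x, y} := by
  rw [Submodule.span_insert, Submodule.span_insert,
    Submodule.span_singleton_smul_eq (IsUnit.mk0 s hs),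
    Submodule.span_singleton_smul_eq (IsUnit.mk0 t ht)]

/-- An orthogonal basis of a complex line may be rescaled by real numbers. -/
theorem isDiagOn_of_scaled (hh : IsHermitianPPM h) {x y : V} {s t : ℝ} (hs : s ≠ 0) (ht : t ≠ 0)
    (hli : LinearIndependent ℂ ![x, y]) (hxy : h x y = 0) {p q : ℂ}
    (hp : s * s * h x x = p) (hq : t * t * h y y = q) :
    IsDiagOn h (Submodule.span ℂ {x, y}) p q := by
  have hs' : (s : ℂ) ≠ 0 := by exact_mod_cast hs
  have ht' : (t : ℂ) ≠ 0 := by exact_mod_cast ht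
  refine ⟨(s : ℂ) • x, (t : ℂ) • y, linearIndependent_smul_pair hs' ht' hli,
    (span_smul_pair hs' ht').symm, ?_, ?_, ?_, ?_⟩
  · simp only [map_smulₛₗ, LinearMap.smul_apply, Complex.conj_ofReal, RingHom.id_apply, ← hp,
      smul_eq_mul, mul_assoc]
  · simp only [map_smulₛₗ, LinearMap.smul_apply, Complex.conj_ofReal, RingHom.id_apply, ← hq,
      smul_eq_mul, mul_assoc]
  · simp only [map_smulₛₗ, LinearMap.smul_apply, hxy, smul_zero]
  · simp only [map_smulₛₗ, LinearMap.smul_apply, hh.eq_zero_symm hxy, smul_zero]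

theorem inv_sqrt_mul_self {r : ℝ} (hr : 0 < r) :
    (((Real.sqrt r)⁻¹ : ℝ) : ℂ) * (((Real.sqrt r)⁻¹ : ℝ) : ℂ) * r = 1 := by
  rw [← Complex.ofReal_mul, ← mul_inv, Real.mul_self_sqrt hr.le, ← Complex.ofReal_mul,
    inv_mul_cancel₀ hr.ne', Complex.ofReal_one]

theorem inv_sqrt_ne_zero {r : ℝ} (hr : 0 < r) : (Real.sqrt r)⁻¹ ≠ 0 :=
  inv_ne_zero (Real.sqrt_pos.mpr hr).ne'

theorem isHyperbolicLine_span (hh : IsHermitianPPM h) {x y : V} {p q : ℝ} (hp : 0 < p)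
    (hq : q < 0) (hli : LinearIndependent ℂ ![x, y]) (hxy : h x y = 0) (hx : h x x = p)
    (hy : h y y = q) : IsHyperbolicLine h (Submodule.span ℂ {x, y}) := by
  have hq' : 0 < -q := by linarith
  refine isDiagOn_of_scaled hh (inv_sqrt_ne_zero hp) (inv_sqrt_ne_zero hq') hli hxy ?_ ?_
  · rw [hx, inv_sqrt_mul_self hp]
  · rw [hy, ← inv_sqrt_mul_self hq']
    push_cast
    ring

theorem isEuclideanLine_span (hh : IsHermitianPPM h) {x y : V} {p : ℝ} (hp : 0 < p)
    (hli : LinearIndependent ℂ ![x, y]) (hxy : h x y = 0) (hx : h x x = p)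
    (hy : h y y = 0) : IsEuclideanLine h (Submodule.span ℂ {x, y}) := by
  refine isDiagOn_of_scaled hh (inv_sqrt_ne_zero hp) one_ne_zero hli hxy ?_ ?_
  · rw [hx, inv_sqrt_mul_self hp]
  · rw [hy, mul_zero]

theorem span_pair_sub_smul (u v : V) (c : ℂ) :
    Submodule.span ℂ {u, v - c • u} = Submodule.span ℂ {u, v} := by
  apply le_antisymm <;> rw [Submodule.span_le, Set.insert_subset_iff, Set.singleton_subset_iff]
  · exact ⟨Submodule.mem_span_pair.mpr ⟨1, 0, by simp⟩,
      Submodule.mem_span_pair.mpr ⟨-c, 1, by module⟩⟩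
  · exact ⟨Submodule.mem_span_pair.mpr ⟨1, 0, by simp⟩,
      Submodule.mem_span_pair.mpr ⟨c, 1, by module⟩⟩

theorem linearIndependent_pair_sub_smul {u v : V} (c : ℂ) (hli : LinearIndependent ℂ ![u, v]) :
    LinearIndependent ℂ ![u, v - c • u] := by
  rw [LinearIndependent.pair_iff] at hli ⊢
  intro s t hst
  obtain ⟨h1, h2⟩ := hli (s - t * c) t (by rw [← hst]; module)
  subst h2
  exact ⟨by simpa using h1, rfl⟩

/-- A line whose Gram determinant vanishes is Euclidean. -/
theorem isEuclideanLine_of_tance_eq_one (hh : IsHermitianPPM h) {u v : V} {a b : ℝ}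
    (hli : LinearIndependent ℂ ![u, v]) (hu : h u u = a) (hv : h v v = b) (ha : a ≠ 0)
    (hc : h u v * h v u = (1 : ℝ) * a * b) : IsEuclideanLine h (Submodule.span ℂ {u, v}) := by
  obtain ⟨hw, hwu⟩ := self_sub_proj hh hu hv ha hc
  rw [sub_self, mul_zero, Complex.ofReal_zero] at hw
  have hli' := linearIndependent_pair_sub_smul (h v u / a) hli
  -- The complement of a negative vector contains no isotropic vector, while `v - (h v u / a) • u`
  -- is isotropic.
  have hapos : 0 < a := by
    by_contra hcon
    have ha' : a < 0 := lt_of_le_of_ne (not_lt.mp hcon) ha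
    have hw0 : v - (h v u / a) • u ≠ 0 := hli'.ne_zero 1
    have := hh.pos_of_orthogonal_neg (x := u) (by simpa [hu]) hw0 hwu
    rw [hw] at this
    exact lt_irrefl 0 this
  rw [← span_pair_sub_smul u v (h v u / a)]
  exact isEuclideanLine_span hh hapos hli' (hh.eq_zero_symm hwu) hu hw

theorem isHyperbolicLine_of_gram_neg (hh : IsHermitianPPM h) {u v : V} {a b τ : ℝ}
    (hli : LinearIndependent ℂ ![u, v]) (hu : h u u = a) (hv : h v v = b) (ha : a ≠ 0)
    (hc : h u v * h v u = τ * a * b) (hneg : a * b * (1 - τ) < 0) :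
    IsHyperbolicLine h (Submodule.span ℂ {u, v}) := by
  obtain ⟨hw, hwu⟩ := self_sub_proj hh hu hv ha hc
  have hli' := linearIndependent_pair_sub_smul (h v u / a) hli
  rw [← span_pair_sub_smul u v (h v u / a)]
  rw [mul_assoc] at hneg
  rcases ha.lt_or_gt with ha | ha
  · rw [Set.pair_comm]
    exact isHyperbolicLine_span hh ((neg_iff_pos_of_mul_neg hneg).mp ha) ha
      (LinearIndependent.pair_symm_iff.mp hli') hwu hw hu
  · exact isHyperbolicLine_span hh ha ((pos_iff_neg_of_mul_neg hneg).mp ha) hli'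
      (hh.eq_zero_symm hwu) hu hw

theorem gram_nonpos_of_isHyperbolicLine {u v : V} {a b τ : ℝ}
    (hu : h u u = a) (hv : h v v = b) (hc : h u v * h v u = τ * a * b)
    (hW : IsHyperbolicLine h (Submodule.span ℂ {u, v})) : a * b * (1 - τ) ≤ 0 := by
  obtain ⟨x, y, -, hspan, hx, hy, hxy, hyx⟩ := hW
  have mu : u ∈ Submodule.span ℂ {x, y} := hspan ▸ Submodule.subset_span (by simp)
  have mv : v ∈ Submodule.span ℂ {x, y} := hspan ▸ Submodule.subset_span (by simp)
  obtain ⟨s, t, rfl⟩ := Submodule.mem_span_pair.mp mu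
  obtain ⟨s', t', rfl⟩ := Submodule.mem_span_pair.mp mv
  simp only [map_add, map_smul, LinearMap.add_apply, LinearMap.smul_apply, smul_eq_mul,
    map_smulₛₗ, hx, hy, hxy, hyx] at hu hv hc
  -- A change of basis multiplies the Gram determinant, here `-1`, by the squared modulus of its
  -- determinant.
  have key : ((a * b * (1 - τ) : ℝ) : ℂ) = (-Complex.normSq (s * t' - t * s') : ℝ) := by
    push_cast
    rw [← Complex.mul_conj, map_sub, map_mul, map_mul]
    have : (a * b * (1 - τ) : ℂ) = a * b - τ * a * b := by ring
    rw [this, ← hc, ← hu, ← hv]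
    ring
  rw [Complex.ofReal_inj] at key
  rw [key]
  linarith [Complex.normSq_nonneg (s * t' - t * s')]

end Lines

/-! ### Independence of the chosen representatives -/

section Points

variable {V : Type*} [AddCommGroup V] [Module ℂ V] {h : V →ₗ[ℂ] V →ₗ⋆[ℂ] ℂ}

theorem line_eq_span (p q : ℙ ℂ V) : line p q = Submodule.span ℂ {p.rep, q.rep} := by
  rw [line, Projectivization.submodule_eq, Projectivization.submodule_eq, ← Submodule.span_insert]

theorem linearIndependent_rep {p q : ℙ ℂ V} (hpq : p ≠ q) :
    LinearIndependent ℂ ![p.rep, q.rep] := by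
  rw [LinearIndependent.pair_iff' p.rep_nonzero]
  intro c hc
  apply hpq
  rw [← p.mk_rep, ← q.mk_rep]
  exact ((Projectivization.mk_eq_mk_iff' ℂ _ _ q.rep_nonzero p.rep_nonzero).mpr ⟨c, hc⟩).symm

theorem exists_pos_normSq_mk (hh : IsHermitianPPM h) {v : V} (hv : v ≠ 0) :
    ∃ r : ℝ, 0 < r ∧ normSq h (Projectivization.mk ℂ v hv) = r * (h v v).re := by
  obtain ⟨a, ha⟩ := Projectivization.exists_smul_eq_mk_rep ℂ v hv
  refine ⟨Complex.normSq a, Complex.normSq_pos.mpr a.ne_zero, ?_⟩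
  rw [normSq, ← ha, Units.smul_def]
  simp only [map_smul, LinearMap.smul_apply, map_smulₛₗ, smul_eq_mul]
  rw [← hh.coe_re v, ← mul_assoc, mul_comm (conj _), Complex.mul_conj, Complex.ofReal_re, ← Complex.ofReal_mul,
    Complex.ofReal_re]

theorem isNegative_mk (hh : IsHermitianPPM h) {v : V} (hv : v ≠ 0) :
    IsNegative h (Projectivization.mk ℂ v hv) ↔ (h v v).re < 0 := by
  obtain ⟨r, hr, he⟩ := exists_pos_normSq_mk hh hv
  rw [IsNegative, he, mul_neg_iff]
  simp [hr, hr.not_gt]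

theorem isIsotropic_mk (hh : IsHermitianPPM h) {v : V} (hv : v ≠ 0) :
    IsIsotropic h (Projectivization.mk ℂ v hv) ↔ (h v v).re = 0 := by
  obtain ⟨r, hr, he⟩ := exists_pos_normSq_mk hh hv
  rw [IsIsotropic, he, mul_eq_zero]
  simp [hr.ne']

theorem isFixedPoint_mk {I : Module.End ℂ V} {v : V} (hv : v ≠ 0) :
    IsFixedPoint I (Projectivization.mk ℂ v hv) ↔ ∃ μ : ℂ, I v = μ • v := by
  obtain ⟨a, ha⟩ := Projectivization.exists_smul_eq_mk_rep ℂ v hv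
  rw [IsFixedPoint, ← ha]
  simp only [Units.smul_def, map_smul]
  refine exists_congr fun μ => ?_
  rw [smul_comm μ]
  exact ⟨fun h => smul_right_injective V a.ne_zero h, fun h => by rw [h]⟩

end Points

end ComplexHyperbolic
namespace ComplexHyperbolic

/-! ### Eigenvalues and eigenvectors of the normalized product -/

section Dynamics

/-- `α / (α⁻² - α)` for a unit complex number `α` with `α³ ≠ 1`, in terms of `χ = chi α`. -/
noncomputable def unitRatio (χ : ℝ) : ℂ := -1 / 2 + χ * Complex.I

/-- The trace, up to normalization, of the product of two special elliptic isometries on the line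
through their centres. -/
noncomputable def traceParam (χ₁ χ₂ τ : ℝ) : ℝ := τ - 1 / 2 - 2 * χ₁ * χ₂

/-- The determinant, up to normalization, of the product of two special elliptic isometries on the
line through their centres. -/
noncomputable def detParam (χ₁ χ₂ : ℝ) : ℝ := (1 + 4 * χ₁ ^ 2) * (1 + 4 * χ₂ ^ 2) / 16

/-- The normalized characteristic polynomial on the line through the centres. -/
noncomputable def lineChar (χ₁ χ₂ τ : ℝ) (z : ℂ) : ℂ :=
  z ^ 2 - traceParam χ₁ χ₂ τ * z + detParam χ₁ χ₂

theorem lineChar_eq (χ₁ χ₂ τ : ℝ) (z : ℂ) :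
    lineChar χ₁ χ₂ τ z =
      z ^ 2 - (2 * unitRatio χ₁ * unitRatio χ₂ + unitRatio χ₁ + unitRatio χ₂ + τ) * z
        + unitRatio χ₁ * unitRatio χ₂ * (1 + unitRatio χ₁) * (1 + unitRatio χ₂) := by
  simp only [lineChar, traceParam, detParam, unitRatio]
  push_cast
  have h1 := Complex.I_sq
  linear_combination (2 * χ₁ * χ₂ * z + χ₁ ^ 2 / 4 + χ₂ ^ 2 / 4
    - (χ₁ : ℂ) ^ 2 * χ₂ ^ 2 * (Complex.I ^ 2 - 1)) * h1

theorem unitRatio_re (χ : ℝ) : (unitRatio χ).re = -1 / 2 := by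
  simp [unitRatio]

theorem unitRatio_im (χ : ℝ) : (unitRatio χ).im = χ := by
  simp [unitRatio]

theorem unitRatio_ne_zero (χ : ℝ) : unitRatio χ ≠ 0 := by
  intro h0
  have := congrArg Complex.re h0
  rw [unitRatio_re] at this
  norm_num at this

/-- The normal eigenvalue is never an eigenvalue on the line. This gives regularity in the elliptic
case and excludes unipotent lifts in the parabolic one. -/
theorem lineChar_normal_ne_zero (χ₁ χ₂ : ℝ) {τ : ℝ} (hτ : τ ≠ 1) :
    lineChar χ₁ χ₂ τ (unitRatio χ₁ * unitRatio χ₂) ≠ 0 := by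
  have : lineChar χ₁ χ₂ τ (unitRatio χ₁ * unitRatio χ₂) =
      unitRatio χ₁ * unitRatio χ₂ * (1 - τ) := by
    rw [lineChar_eq]; ring
  rw [this]
  refine mul_ne_zero (mul_ne_zero (unitRatio_ne_zero _) (unitRatio_ne_zero _)) ?_
  rw [sub_ne_zero]
  exact_mod_cast hτ.symm

theorem one_add_four_sq_pos (χ : ℝ) : 0 < 1 + 4 * χ ^ 2 := by positivity

/-- The squared term is the coefficient of `y` in `IsLineFrame.lineEigenvector_self`; this form
serves both the case `0 < τ < 1` and the comparison of norms on a hyperbolic line. -/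
theorem neg_discr_eq (χ₁ χ₂ τ : ℝ) :
    4 * detParam χ₁ χ₂ - traceParam χ₁ χ₂ τ ^ 2 =
      (χ₁ - χ₂ + 2 * τ * χ₂) ^ 2 + τ * (1 - τ) * (1 + 4 * χ₂ ^ 2) := by
  simp only [detParam, traceParam]
  ring

theorem unitRatio_chi {α : ℂ} (hα : ‖α‖ = 1) (hα' : α ^ 3 ≠ 1) :
    α⁻¹ ^ 2 - α ≠ 0 ∧ α = (α⁻¹ ^ 2 - α) * unitRatio (chi α) := by
  have h0 : α ≠ 0 := by
    rintro rfl
    simp at hα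
  have hb : α⁻¹ ^ 2 - α ≠ 0 := by
    intro hz
    apply hα'
    have : α⁻¹ ^ 2 = α := sub_eq_zero.mp hz
    calc α ^ 3 = α * α ^ 2 := by ring
      _ = α⁻¹ ^ 2 * α ^ 2 := by rw [this]
      _ = 1 := by field_simp
  refine ⟨hb, ?_⟩
  have hconj : conj α = α⁻¹ := (Complex.inv_eq_conj hα).symm
  have hb' : α - α⁻¹ ^ 2 ≠ 0 := by
    rw [← neg_sub]; exact neg_ne_zero.mpr hb
  have hb'' : 1 - α ^ 3 ≠ 0 := sub_ne_zero.mpr (Ne.symm hα')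
  have hre : (α / (α⁻¹ ^ 2 - α)).re = -1 / 2 := by
    -- Conjugation inverts `α`, so twice the real part becomes a rational expression in `α`.
    have hsum : α / (α⁻¹ ^ 2 - α) + conj (α / (α⁻¹ ^ 2 - α)) = -1 := by
      rw [map_div₀, map_sub, map_pow, map_inv₀, hconj, inv_inv]
      have e1 : α⁻¹ ^ 2 - α = (1 - α ^ 3) / α ^ 2 := by field_simp
      have e2 : α ^ 2 - α⁻¹ = -(1 - α ^ 3) / α := by field_simp; ring
      rw [e1, e2]
      field_simp
      ring
    have := congrArg Complex.re hsum
    simp only [Complex.add_re, Complex.conj_re, Complex.neg_re, Complex.one_re] at this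
    linarith
  have : α / (α⁻¹ ^ 2 - α) = unitRatio (chi α) := by
    apply Complex.ext
    · rw [hre, unitRatio_re]
    · rw [unitRatio_im, chi]
  rw [← this, mul_div_cancel₀ _ hb]

variable {V : Type*} [AddCommGroup V] [Module ℂ V] {h : V →ₗ[ℂ] V →ₗ⋆[ℂ] ℂ}

/-- The special elliptic isometry divided by `α⁻² - α`. -/
noncomputable def normalizedElliptic (h : V →ₗ[ℂ] V →ₗ⋆[ℂ] ℂ) (u : V) (A : ℂ) :
    Module.End ℂ V :=
  ((h u u)⁻¹ • h.flip u).smulRight u + A • LinearMap.id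

theorem normalizedElliptic_apply (u x : V) (A : ℂ) :
    normalizedElliptic h u A x = (h x u / h u u) • u + A • x := by
  simp [normalizedElliptic, div_eq_inv_mul]

theorem specialElliptic_eq_smul (p : ℙ ℂ V) {α : ℂ} (hα : ‖α‖ = 1) (hα' : α ^ 3 ≠ 1) :
    specialElliptic h p α =
      (α⁻¹ ^ 2 - α) • normalizedElliptic h p.rep (unitRatio (chi α)) := by
  obtain ⟨-, he⟩ := unitRatio_chi hα hα'
  ext x
  rw [LinearMap.smul_apply, normalizedElliptic_apply, smul_add, smul_smul, smul_smul, ← he]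
  rfl

/-- The product of two normalized special elliptic isometries. -/
noncomputable def normalizedProd (h : V →ₗ[ℂ] V →ₗ⋆[ℂ] ℂ) (u v : V) (χ₁ χ₂ : ℝ) :
    Module.End ℂ V :=
  normalizedElliptic h v (unitRatio χ₂) * normalizedElliptic h u (unitRatio χ₁)

/-- The eigenvector, in the line spanned by `u` and `v`, for a root `z` of `lineChar`. -/
noncomputable def lineEigenvector (h : V →ₗ[ℂ] V →ₗ⋆[ℂ] ℂ) (u v : V) (a χ₁ χ₂ : ℝ) (z : ℂ) : V :=
  (unitRatio χ₂ * (h v u / a)) • u + (z - (1 + unitRatio χ₁) * unitRatio χ₂) • v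

namespace IsLineFrame

variable {u v n : V} {a b τ : ℝ}

theorem prod_apply (F : IsLineFrame h u v n a b τ) (χ₁ χ₂ : ℝ) (s t r : ℂ) :
    normalizedProd h u v χ₁ χ₂ (s • u + t • v + r • n) =
      ((1 + unitRatio χ₁) * unitRatio χ₂ * s + unitRatio χ₂ * (h v u / a) * t) • u
      + ((1 + unitRatio χ₁) * (h u v / b) * s + (unitRatio χ₁ * (1 + unitRatio χ₂) + τ) * t) • v
      + (unitRatio χ₁ * unitRatio χ₂ * r) • n := by
  have ha : (a : ℂ) ≠ 0 := by exact_mod_cast F.left_ne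
  have hb : (b : ℂ) ≠ 0 := by exact_mod_cast F.right_ne
  have hτ : (τ : ℂ) = h v u / a * (h u v / b) := by
    have := F.mul_eq
    field_simp
    linear_combination -this
  rw [normalizedProd, Module.End.mul_apply, normalizedElliptic_apply, normalizedElliptic_apply]
  simp only [map_add, map_smul, LinearMap.add_apply, LinearMap.smul_apply, smul_eq_mul,
    F.self_left, F.self_right, F.normal_left, F.normal_right, mul_zero, add_zero]
  have e1 : (s * a + t * h v u) / a = s + t * (h v u / a) := by field_simp
  rw [e1]
  have e2 : ((s + t * (h v u / a)) * h u v + unitRatio χ₁ * (s * h u v + t * b)) / b =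
      (s + t * (h v u / a)) * (h u v / b) + unitRatio χ₁ * (s * (h u v / b) + t) := by field_simp
  rw [e2, hτ]
  module

/-- A nonzero off-diagonal entry makes each eigenspace of the block on the line one-dimensional,
even at a double root. -/
theorem off_diag_ne_zero (F : IsLineFrame h u v n a b τ) (χ : ℝ) :
    unitRatio χ * (h v u / a) ≠ 0 := by
  have ha : (a : ℂ) ≠ 0 := by exact_mod_cast F.left_ne
  refine mul_ne_zero (unitRatio_ne_zero _) (div_ne_zero (fun h0 => ?_) ha)
  have := F.mul_eq
  rw [h0, mul_zero] at this
  have h2 : τ * a * b = 0 := by exact_mod_cast this.symm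
  exact mul_ne_zero (mul_ne_zero F.tance_ne_zero F.left_ne) F.right_ne h2

theorem lineEigenvector_ne_zero (F : IsLineFrame h u v n a b τ) (χ₁ χ₂ : ℝ) (z : ℂ) :
    lineEigenvector h u v a χ₁ χ₂ z ≠ 0 := by
  intro h0
  refine F.off_diag_ne_zero χ₂
    (F.eq_zero _ (z - (1 + unitRatio χ₁) * unitRatio χ₂) 0 ?_).1
  rw [zero_smul, add_zero]
  exact h0

theorem prod_lineEigenvector (F : IsLineFrame h u v n a b τ) {χ₁ χ₂ : ℝ} {z : ℂ}
    (hz : lineChar χ₁ χ₂ τ z = 0) :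
    normalizedProd h u v χ₁ χ₂ (lineEigenvector h u v a χ₁ χ₂ z) =
      z • lineEigenvector h u v a χ₁ χ₂ z := by
  have ha : (a : ℂ) ≠ 0 := by exact_mod_cast F.left_ne
  have hb : (b : ℂ) ≠ 0 := by exact_mod_cast F.right_ne
  have hτ : (τ : ℂ) = h v u / a * (h u v / b) := by
    have := F.mul_eq
    field_simp
    linear_combination -this
  rw [lineChar_eq] at hz
  have := F.prod_apply χ₁ χ₂ (unitRatio χ₂ * (h v u / a))
    (z - (1 + unitRatio χ₁) * unitRatio χ₂) 0
  rw [zero_smul, add_zero, mul_zero, zero_smul, add_zero] at this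
  rw [lineEigenvector, this, smul_add, smul_smul, smul_smul]
  congr 2
  · ring
  · linear_combination -hz - (1 + unitRatio χ₁) * unitRatio χ₂ * hτ

theorem prod_normal (F : IsLineFrame h u v n a b τ) (χ₁ χ₂ : ℝ) :
    normalizedProd h u v χ₁ χ₂ n = (unitRatio χ₁ * unitRatio χ₂) • n := by
  simpa using F.prod_apply χ₁ χ₂ 0 0 1

/-- Every eigenvector is normal to the line or a multiple of some `lineEigenvector`. -/
theorem eigenvector_cases (F : IsLineFrame h u v n a b τ) {χ₁ χ₂ : ℝ} {x : V} {z : ℂ}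
    (hx : normalizedProd h u v χ₁ χ₂ x = z • x) :
    (∃ r : ℂ, x = r • n) ∨
      lineChar χ₁ χ₂ τ z = 0 ∧ ∃ k : ℂ, x = k • lineEigenvector h u v a χ₁ χ₂ z := by
  obtain ⟨s, t, r, rfl⟩ := F.exists_eq x
  rw [F.prod_apply, ← sub_eq_zero] at hx
  have hτ : (τ : ℂ) = h v u / a * (h u v / b) := by
    have ha : (a : ℂ) ≠ 0 := by exact_mod_cast F.left_ne
    have hb : (b : ℂ) ≠ 0 := by exact_mod_cast F.right_ne
    have := F.mul_eq
    field_simp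
    linear_combination -this
  have hm := F.off_diag_ne_zero χ₂
  set m := unitRatio χ₂ * (h v u / a) with hmdef
  obtain ⟨e1, e2, e3⟩ := F.eq_zero
    ((1 + unitRatio χ₁) * unitRatio χ₂ * s + m * t - z * s)
    ((1 + unitRatio χ₁) * (h u v / b) * s + (unitRatio χ₁ * (1 + unitRatio χ₂) + τ) * t - z * t)
    (unitRatio χ₁ * unitRatio χ₂ * r - z * r) (by rw [← hx]; module)
  have ht : t = s / m * (z - (1 + unitRatio χ₁) * unitRatio χ₂) := by
    field_simp
    linear_combination e1
  by_cases hs : s = 0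
  · left
    subst hs
    rw [zero_div, zero_mul] at ht
    subst ht
    exact ⟨r, by simp⟩
  · right
    have hz : lineChar χ₁ χ₂ τ z = 0 := by
      -- Eliminating `t` from the two rows leaves the characteristic polynomial.
      have h3 : s * lineChar χ₁ χ₂ τ z = 0 := by
        rw [lineChar_eq]
        linear_combination (-m) * e2 - (z - unitRatio χ₁ * (1 + unitRatio χ₂) - τ) * e1
          - s * (1 + unitRatio χ₁) * unitRatio χ₂ * hτ
          + s * (1 + unitRatio χ₁) * (h u v / b) * hmdef
      exact (mul_eq_zero.mp h3).resolve_left hs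
    refine ⟨hz, s / m, ?_⟩
    have hr : r = 0 := by
      have h4 : (unitRatio χ₁ * unitRatio χ₂ - z) * r = 0 := by linear_combination e3
      refine (mul_eq_zero.mp h4).resolve_left (fun h5 => ?_)
      apply lineChar_normal_ne_zero χ₁ χ₂ F.tance_ne_one
      rw [sub_eq_zero.mp h5, hz]
    rw [lineEigenvector, smul_add, smul_smul, smul_smul, ← ht, hr, zero_smul, add_zero,
      ← hmdef, div_mul_cancel₀ s hm]

/-- The norm of a `lineEigenvector`. -/
theorem lineEigenvector_self (F : IsLineFrame h u v n a b τ) (χ₁ χ₂ x y : ℝ) :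
    (h (lineEigenvector h u v a χ₁ χ₂ (x + y * Complex.I))
      (lineEigenvector h u v a χ₁ χ₂ (x + y * Complex.I))).re =
      b * (x ^ 2 - traceParam χ₁ χ₂ τ * x + detParam χ₁ χ₂ + y ^ 2
        + y * (χ₁ - χ₂ + 2 * τ * χ₂)) := by
  have ha : (a : ℂ) ≠ 0 := by exact_mod_cast F.left_ne
  have hc : h u v = τ * a * b / h v u := by
    rw [← F.mul_eq, mul_div_cancel_right₀]
    intro h0
    -- The value `0` of `χ` is arbitrary: only `h v u ≠ 0` is extracted.
    have := F.off_diag_ne_zero 0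
    simp [h0] at this
  have hc0 : h v u ≠ 0 := by
    intro h0
    have := F.off_diag_ne_zero 0
    simp [h0] at this
  have key : h (lineEigenvector h u v a χ₁ χ₂ (x + y * Complex.I))
      (lineEigenvector h u v a χ₁ χ₂ (x + y * Complex.I)) =
      b * (τ * unitRatio χ₂ * conj (unitRatio χ₂)
        + (x + y * Complex.I - (1 + unitRatio χ₁) * unitRatio χ₂)
          * conj (x + y * Complex.I - (1 + unitRatio χ₁) * unitRatio χ₂)
        + τ * (unitRatio χ₂ * conj (x + y * Complex.I - (1 + unitRatio χ₁) * unitRatio χ₂)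
          + conj (unitRatio χ₂) * (x + y * Complex.I - (1 + unitRatio χ₁) * unitRatio χ₂))) := by
    rw [lineEigenvector]
    generalize (x + y * Complex.I - (1 + unitRatio χ₁) * unitRatio χ₂ : ℂ) = w
    simp only [map_add, map_smul, LinearMap.add_apply, LinearMap.smul_apply, smul_eq_mul,
      map_smulₛₗ, map_mul, map_div₀, F.hermitian.conj_symm, Complex.conj_ofReal, F.self_left,
      F.self_right, hc]
    field_simp
    ring
  rw [key]
  simp only [traceParam, detParam, Complex.add_re, Complex.mul_re,
    Complex.mul_im, Complex.conj_re, Complex.conj_im, Complex.sub_re, Complex.sub_im,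
    Complex.add_im, Complex.ofReal_re, Complex.ofReal_im, Complex.I_re, Complex.I_im,
    Complex.one_re, Complex.one_im, unitRatio_re, unitRatio_im]
  ring

end IsLineFrame

end Dynamics

end ComplexHyperbolic
namespace ComplexHyperbolic

/-! ### From the discriminant to the type of the isometry -/

section Classification

theorem lineChar_eq_zero_of_discr_neg {χ₁ χ₂ τ x y : ℝ} (hx : 2 * x = traceParam χ₁ χ₂ τ)
    (hy : 4 * y ^ 2 = 4 * detParam χ₁ χ₂ - traceParam χ₁ χ₂ τ ^ 2) :
    lineChar χ₁ χ₂ τ (x + y * Complex.I) = 0 := by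
  have hx' : (2 * x : ℂ) = traceParam χ₁ χ₂ τ := by exact_mod_cast hx
  have hy' : (4 * y ^ 2 : ℂ) = 4 * detParam χ₁ χ₂ - traceParam χ₁ χ₂ τ ^ 2 := by exact_mod_cast hy
  rw [lineChar]
  linear_combination (x + y * Complex.I : ℂ) * hx' + (y : ℂ) ^ 2 * Complex.I_sq
    - hy' / 4 - (2 * x + traceParam χ₁ χ₂ τ : ℂ) / 4 * hx'

theorem lineChar_eq_zero_iff {χ₁ χ₂ τ : ℝ}
    (hD : 0 ≤ traceParam χ₁ χ₂ τ ^ 2 - 4 * detParam χ₁ χ₂) (z : ℂ) :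
    lineChar χ₁ χ₂ τ z = 0 ↔
      z = ((traceParam χ₁ χ₂ τ + √(traceParam χ₁ χ₂ τ ^ 2 - 4 * detParam χ₁ χ₂)) / 2 : ℝ) ∨
      z = ((traceParam χ₁ χ₂ τ - √(traceParam χ₁ χ₂ τ ^ 2 - 4 * detParam χ₁ χ₂)) / 2 : ℝ) := by
  have hs := Real.sq_sqrt hD
  set s := √(traceParam χ₁ χ₂ τ ^ 2 - 4 * detParam χ₁ χ₂)
  have hs' : (s : ℂ) ^ 2 = traceParam χ₁ χ₂ τ ^ 2 - 4 * detParam χ₁ χ₂ := by exact_mod_cast hs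
  have : lineChar χ₁ χ₂ τ z = (z - ((traceParam χ₁ χ₂ τ + s) / 2 : ℝ)) *
      (z - ((traceParam χ₁ χ₂ τ - s) / 2 : ℝ)) := by
    rw [lineChar]
    push_cast
    linear_combination hs' / 4
  rw [this, mul_eq_zero, sub_eq_zero, sub_eq_zero]

variable {V : Type*} [AddCommGroup V] [Module ℂ V] {h : V →ₗ[ℂ] V →ₗ⋆[ℂ] ℂ}

theorem isFixedPoint_smul {I : Module.End ℂ V} {κ : ℂ} (hκ : κ ≠ 0) (p : ℙ ℂ V) :
    IsFixedPoint (κ • I) p ↔ IsFixedPoint I p := by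
  constructor
  · rintro ⟨μ, hμ⟩
    refine ⟨κ⁻¹ * μ, ?_⟩
    rw [mul_smul, ← hμ, LinearMap.smul_apply, inv_smul_smul₀ hκ]
  · rintro ⟨μ, hμ⟩
    exact ⟨κ * μ, by rw [LinearMap.smul_apply, hμ, mul_smul]⟩

theorem eq_zero_of_isNilpotent {N : Module.End ℂ V} (hN : IsNilpotent N) {x : V} (hx : x ≠ 0)
    {c : ℂ} (hc : N x = c • x) : c = 0 := by
  obtain ⟨k, hk⟩ := hN
  have hpow : ∀ m : ℕ, (N ^ m) x = c ^ m • x := by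
    intro m
    induction m with
    | zero => simp
    | succ m ih => rw [pow_succ, Module.End.mul_apply, hc, map_smul, ih, smul_smul, pow_succ']
  have := hpow k
  rw [hk, LinearMap.zero_apply] at this
  exact eq_zero_of_pow_eq_zero ((smul_eq_zero.mp this.symm).resolve_right hx)

namespace IsLineFrame

variable {u v n : V} {a b τ : ℝ}

theorem tance_mul_pos (F : IsLineFrame h u v n a b τ) : 0 < τ * (a * b) := by
  have h1 : ((τ * (a * b) : ℝ) : ℂ) = Complex.normSq (h u v) := by
    rw [← Complex.mul_conj, F.hermitian.conj_symm, F.mul_eq]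
    push_cast
    ring
  have h2 : τ * (a * b) = Complex.normSq (h u v) := by exact_mod_cast h1
  exact lt_of_le_of_ne (h2 ▸ Complex.normSq_nonneg _)
    (mul_ne_zero F.tance_ne_zero (mul_ne_zero F.left_ne F.right_ne)).symm

theorem fixedPoint_cases (F : IsLineFrame h u v n a b τ) {χ₁ χ₂ : ℝ} {p : ℙ ℂ V}
    (hp : IsFixedPoint (normalizedProd h u v χ₁ χ₂) p) :
    p = Projectivization.mk ℂ n F.normal_ne_zero ∨
      ∃ z, lineChar χ₁ χ₂ τ z = 0 ∧
        p = Projectivization.mk ℂ _ (F.lineEigenvector_ne_zero χ₁ χ₂ z) := by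
  obtain ⟨μ, hμ⟩ := hp
  rcases F.eigenvector_cases hμ with ⟨r, hr⟩ | ⟨hz, k, hk⟩
  · left
    rw [← p.mk_rep, Projectivization.mk_eq_mk_iff']
    exact ⟨r, hr.symm⟩
  · right
    refine ⟨μ, hz, ?_⟩
    conv_lhs => rw [← p.mk_rep]
    rw [Projectivization.mk_eq_mk_iff']
    exact ⟨k, hk.symm⟩

/-- Counting fixed points on the line thereby reduces to counting roots of `lineChar`. -/
theorem mk_lineEigenvector_injective (F : IsLineFrame h u v n a b τ) (χ₁ χ₂ : ℝ) :
    Function.Injective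
      fun z => Projectivization.mk ℂ _ (F.lineEigenvector_ne_zero χ₁ χ₂ z) := by
  intro z w hzw
  obtain ⟨k, hk⟩ := (Projectivization.mk_eq_mk_iff' ℂ _ _ _ _).mp hzw
  rw [lineEigenvector, lineEigenvector, ← sub_eq_zero] at hk
  obtain ⟨e1, e2, -⟩ := F.eq_zero
    (k * (unitRatio χ₂ * (h v u / a)) - unitRatio χ₂ * (h v u / a))
    (k * (w - (1 + unitRatio χ₁) * unitRatio χ₂) - (z - (1 + unitRatio χ₁) * unitRatio χ₂)) 0
    (by rw [← hk]; module)
  have hk1 : k = 1 := by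
    have : (k - 1) * (unitRatio χ₂ * (h v u / a)) = 0 := by linear_combination e1
    exact sub_eq_zero.mp ((mul_eq_zero.mp this).resolve_right (F.off_diag_ne_zero χ₂))
  subst hk1
  linear_combination -e2

theorem isRegularElliptic (F : IsLineFrame h u v n a b τ) {χ₁ χ₂ : ℝ} {κ : ℂ} (hκ : κ ≠ 0)
    (hD : traceParam χ₁ χ₂ τ ^ 2 - 4 * detParam χ₁ χ₂ < 0) :
    IsRegularElliptic h (κ • normalizedProd h u v χ₁ χ₂) := by
  have hh := F.hermitian
  set x := traceParam χ₁ χ₂ τ / 2 with hxdef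
  set y := √((4 * detParam χ₁ χ₂ - traceParam χ₁ χ₂ τ ^ 2) / 4) with hydef
  have hx : 2 * x = traceParam χ₁ χ₂ τ := by rw [hxdef]; ring
  have hypos : 0 < y := Real.sqrt_pos.mpr (by linarith)
  have hy : 4 * y ^ 2 = 4 * detParam χ₁ χ₂ - traceParam χ₁ χ₂ τ ^ 2 := by
    rw [hydef, Real.sq_sqrt (by linarith)]
    ring
  have hz := lineChar_eq_zero_of_discr_neg hx hy
  have hw := lineChar_eq_zero_of_discr_neg (y := -y) hx (by rw [← hy]; ring)
  have hzw : (x + y * Complex.I : ℂ) ≠ x + (-y : ℝ) * Complex.I := by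
    intro he
    have := congrArg Complex.im he
    simp at this
    linarith
  have hNz := F.lineEigenvector_self χ₁ χ₂ x y
  have hNw := F.lineEigenvector_self χ₁ χ₂ x (-y)
  set z : ℂ := x + y * Complex.I
  set w : ℂ := x + (-y : ℝ) * Complex.I
  have heig : ∀ {s : ℂ} {e : V}, normalizedProd h u v χ₁ χ₂ e = s • e →
      (κ • normalizedProd h u v χ₁ χ₂) e = (κ * s) • e := by
    intro s e hse
    rw [LinearMap.smul_apply, hse, mul_smul]
  have hneg : ∀ {s : ℂ} {e : V}, e ≠ 0 → normalizedProd h u v χ₁ χ₂ e = s • e →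
      (h e e).re < 0 → IsElliptic h (κ • normalizedProd h u v χ₁ χ₂) := fun h0 hse hlt =>
    ⟨_, (isNegative_mk hh h0).mpr hlt, (isFixedPoint_mk h0).mpr ⟨_, heig hse⟩⟩
  refine ⟨?_, ![κ * z, κ * w, κ * (unitRatio χ₁ * unitRatio χ₂)], ?_, ?_⟩
  · have hne : a * b * (1 - τ) ≠ 0 := mul_ne_zero (mul_ne_zero F.left_ne F.right_ne)
      (sub_ne_zero.mpr F.tance_ne_one.symm)
    rcases hne.lt_or_gt with hlt | hgt
    · have hprod : b * (y * (2 * y + (χ₁ - χ₂ + 2 * τ * χ₂))) *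
          (b * (y * (2 * y - (χ₁ - χ₂ + 2 * τ * χ₂)))) < 0 := by
        have h4 : 4 * y ^ 2 - (χ₁ - χ₂ + 2 * τ * χ₂) ^ 2 =
            τ * (1 - τ) * (1 + 4 * χ₂ ^ 2) := by
          rw [hy, neg_discr_eq]; ring
        have h5 : τ * (1 - τ) < 0 := by
          have h6 : τ * (1 - τ) * (a * b) ^ 2 < 0 := by
            have := mul_neg_of_pos_of_neg F.tance_mul_pos hlt
            linarith
          by_contra hcon
          exact absurd h6 (not_lt.mpr (mul_nonneg (not_lt.mp hcon) (sq_nonneg _)))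
        have h7 : τ * (1 - τ) * (1 + 4 * χ₂ ^ 2) < 0 :=
          mul_neg_of_neg_of_pos h5 (one_add_four_sq_pos χ₂)
        have h8 : 0 < b ^ 2 * y ^ 2 := mul_pos (sq_pos_of_ne_zero F.right_ne) (by positivity)
        have := mul_neg_of_pos_of_neg h8 h7
        rw [← h4] at this
        linarith
      have e1 : (h (lineEigenvector h u v a χ₁ χ₂ z) (lineEigenvector h u v a χ₁ χ₂ z)).re =
          b * (y * (2 * y + (χ₁ - χ₂ + 2 * τ * χ₂))) := by
        rw [hNz, ← hx]
        linear_combination b * (-hy / 4 + (2 * x + traceParam χ₁ χ₂ τ) / 4 * hx)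
      have e2 : (h (lineEigenvector h u v a χ₁ χ₂ w) (lineEigenvector h u v a χ₁ χ₂ w)).re =
          b * (y * (2 * y - (χ₁ - χ₂ + 2 * τ * χ₂))) := by
        rw [hNw, ← hx]
        linear_combination b * (-hy / 4 + (2 * x + traceParam χ₁ χ₂ τ) / 4 * hx)
      rcases mul_neg_iff.mp hprod with ⟨-, hl⟩ | ⟨hl, -⟩
      · exact hneg (F.lineEigenvector_ne_zero _ _ _) (F.prod_lineEigenvector hw) (e2 ▸ hl)
      · exact hneg (F.lineEigenvector_ne_zero _ _ _) (F.prod_lineEigenvector hz) (e1 ▸ hl)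
    · exact hneg F.normal_ne_zero (F.prod_normal χ₁ χ₂) (F.normal_neg hgt)
  · have hn := lineChar_normal_ne_zero χ₁ χ₂ F.tance_ne_one
    have hzn : z ≠ unitRatio χ₁ * unitRatio χ₂ := fun he => hn (he ▸ hz)
    have hwn : w ≠ unitRatio χ₁ * unitRatio χ₂ := fun he => hn (he ▸ hw)
    intro i j hij
    fin_cases i <;> fin_cases j <;> simp_all
  · have hev : ∀ {s : ℂ} {e : V}, e ≠ 0 → normalizedProd h u v χ₁ χ₂ e = s • e →
        Module.End.HasEigenvalue (κ • normalizedProd h u v χ₁ χ₂) (κ * s) := fun h0 hse =>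
      Module.End.hasEigenvalue_of_hasEigenvector
        ⟨Module.End.mem_eigenspace_iff.mpr (heig hse), h0⟩
    intro i
    fin_cases i
    · exact hev (F.lineEigenvector_ne_zero _ _ _) (F.prod_lineEigenvector hz)
    · exact hev (F.lineEigenvector_ne_zero _ _ _) (F.prod_lineEigenvector hw)
    · exact hev F.normal_ne_zero (F.prod_normal χ₁ χ₂)

/-- At a real root, the norm formula with `y = 0` is `b` times the characteristic polynomial. -/
theorem lineEigenvector_isotropic (F : IsLineFrame h u v n a b τ) {χ₁ χ₂ : ℝ}
    (hD : 0 ≤ traceParam χ₁ χ₂ τ ^ 2 - 4 * detParam χ₁ χ₂) {z : ℂ}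
    (hz : lineChar χ₁ χ₂ τ z = 0) :
    (h (lineEigenvector h u v a χ₁ χ₂ z) (lineEigenvector h u v a χ₁ χ₂ z)).re = 0 := by
  obtain ⟨x, rfl⟩ : ∃ x : ℝ, z = x := by
    rcases (lineChar_eq_zero_iff hD z).mp hz with he | he <;> exact ⟨_, he⟩
  have hx : x ^ 2 - traceParam χ₁ χ₂ τ * x + detParam χ₁ χ₂ = 0 := by
    rw [lineChar] at hz
    exact_mod_cast hz
  have := F.lineEigenvector_self χ₁ χ₂ x 0
  simp only [Complex.ofReal_zero, zero_mul, add_zero, hx] at this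
  rw [this]
  simp

/-- When the discriminant is nonnegative and the line is hyperbolic, the only nonisotropic fixed
point is the positive point orthogonal to the line. -/
theorem not_isElliptic (F : IsLineFrame h u v n a b τ) {χ₁ χ₂ : ℝ} {κ : ℂ} (hκ : κ ≠ 0)
    (hD : 0 ≤ traceParam χ₁ χ₂ τ ^ 2 - 4 * detParam χ₁ χ₂) (hneg : a * b * (1 - τ) < 0) :
    ¬ IsElliptic h (κ • normalizedProd h u v χ₁ χ₂) := by
  rintro ⟨p, hp, hfix⟩
  rw [isFixedPoint_smul hκ] at hfix
  rcases F.fixedPoint_cases hfix with rfl | ⟨z, hz, rfl⟩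
  · rw [isNegative_mk F.hermitian] at hp
    exact hp.not_gt (F.normal_pos hneg)
  · rw [isNegative_mk F.hermitian, F.lineEigenvector_isotropic hD hz] at hp
    exact lt_irrefl 0 hp

theorem isotropicFixedPoints_eq (F : IsLineFrame h u v n a b τ) {χ₁ χ₂ : ℝ} {κ : ℂ} (hκ : κ ≠ 0)
    (hD : 0 ≤ traceParam χ₁ χ₂ τ ^ 2 - 4 * detParam χ₁ χ₂) (hneg : a * b * (1 - τ) < 0) :
    isotropicFixedPoints h (κ • normalizedProd h u v χ₁ χ₂) =
      (fun z => Projectivization.mk ℂ _ (F.lineEigenvector_ne_zero χ₁ χ₂ z)) ''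
        {z | lineChar χ₁ χ₂ τ z = 0} := by
  ext p
  rw [isotropicFixedPoints, Set.mem_ofPred_eq, isFixedPoint_smul hκ, Set.mem_image]
  constructor
  · rintro ⟨hp, hfix⟩
    rcases F.fixedPoint_cases hfix with rfl | ⟨z, hz, rfl⟩
    · rw [isIsotropic_mk F.hermitian] at hp
      exact absurd hp (F.normal_pos hneg).ne'
    · exact ⟨z, hz, rfl⟩
  · rintro ⟨z, hz, rfl⟩
    exact ⟨(isIsotropic_mk F.hermitian _).mpr (F.lineEigenvector_isotropic hD hz),
      (isFixedPoint_mk _).mpr ⟨z, F.prod_lineEigenvector hz⟩⟩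

/-- A unipotent map has `1` as its only eigenvalue, whereas the eigenvalues on the line and on the
normal differ. -/
theorem not_hasUnipotentLift (F : IsLineFrame h u v n a b τ) {χ₁ χ₂ : ℝ} {κ z : ℂ}
    (hz : lineChar χ₁ χ₂ τ z = 0) : ¬ HasUnipotentLift (κ • normalizedProd h u v χ₁ χ₂) := by
  rintro ⟨δ, -, hN⟩
  have e1 := eq_zero_of_isNilpotent hN (F.lineEigenvector_ne_zero χ₁ χ₂ z) (c := δ * κ * z - 1)
    (by simp only [LinearMap.sub_apply, LinearMap.smul_apply, F.prod_lineEigenvector hz,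
          Module.End.one_apply]
        module)
  have e2 := eq_zero_of_isNilpotent hN F.normal_ne_zero
    (c := δ * κ * (unitRatio χ₁ * unitRatio χ₂) - 1)
    (by simp only [LinearMap.sub_apply, LinearMap.smul_apply, F.prod_normal,
          Module.End.one_apply]
        module)
  have h0 : δ * κ ≠ 0 := by
    intro h0
    rw [h0, zero_mul, zero_sub] at e1
    exact neg_ne_zero.mpr one_ne_zero e1
  have : z = unitRatio χ₁ * unitRatio χ₂ := mul_left_cancel₀ h0 (by linear_combination e1 - e2)
  exact lineChar_normal_ne_zero χ₁ χ₂ F.tance_ne_one (this ▸ hz)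

theorem isElliptoParabolic (F : IsLineFrame h u v n a b τ) {χ₁ χ₂ : ℝ} {κ : ℂ} (hκ : κ ≠ 0)
    (hD : traceParam χ₁ χ₂ τ ^ 2 - 4 * detParam χ₁ χ₂ = 0) (hneg : a * b * (1 - τ) < 0) :
    IsElliptoParabolic h (κ • normalizedProd h u v χ₁ χ₂) := by
  have hroots := lineChar_eq_zero_iff hD.ge
  simp only [hD, Real.sqrt_zero, add_zero, sub_zero, or_self] at hroots
  refine ⟨⟨F.not_isElliptic hκ hD.ge hneg, ?_⟩, F.not_hasUnipotentLift ((hroots _).mpr rfl)⟩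
  rw [F.isotropicFixedPoints_eq hκ hD.ge hneg,
    Set.ncard_image_of_injective _ (F.mk_lineEigenvector_injective χ₁ χ₂)]
  simp only [hroots, Set.ofPred_eq_eq_singleton, Set.ncard_singleton]

theorem isLoxodromic (F : IsLineFrame h u v n a b τ) {χ₁ χ₂ : ℝ} {κ : ℂ} (hκ : κ ≠ 0)
    (hD : 0 < traceParam χ₁ χ₂ τ ^ 2 - 4 * detParam χ₁ χ₂) (hneg : a * b * (1 - τ) < 0) :
    IsLoxodromic h (κ • normalizedProd h u v χ₁ χ₂) := by
  refine ⟨F.not_isElliptic hκ hD.le hneg, ?_⟩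
  rw [F.isotropicFixedPoints_eq hκ hD.le hneg,
    Set.ncard_image_of_injective _ (F.mk_lineEigenvector_injective χ₁ χ₂)]
  simp only [lineChar_eq_zero_iff hD.le]
  refine Set.ncard_pair ?_
  rw [Ne, Complex.ofReal_inj]
  have := Real.sqrt_pos.mpr hD
  intro he
  linarith

end IsLineFrame

/-- The discriminant factors through `(1 + 4χ₁χ₂ ± √…) / 2`, and its sign is decided by the factor
belonging to the sign `σ` of the line. -/
theorem exists_discr_factor {χ₁ χ₂ τ σ : ℝ} (hσ : σ = 1 ∧ 1 < τ ∨ σ = -1 ∧ τ < 0) :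
    ∃ c : ℝ, 0 < c ∧ traceParam χ₁ χ₂ τ ^ 2 - 4 * detParam χ₁ χ₂ =
      c * (σ * τ - σ * ((1 + 4 * χ₁ * χ₂ +
        σ * √((1 + 4 * χ₁ ^ 2) * (1 + 4 * χ₂ ^ 2))) / 2)) := by
  have hsq : 0 ≤ (1 + 4 * χ₁ ^ 2) * (1 + 4 * χ₂ ^ 2) := by positivity
  have hS := Real.sq_sqrt hsq
  -- The squares differ by `4(χ₁ - χ₂)²`.
  have hle : |1 + 4 * χ₁ * χ₂| ≤ √((1 + 4 * χ₁ ^ 2) * (1 + 4 * χ₂ ^ 2)) := by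
    apply Real.abs_le_sqrt
    have := sq_nonneg (χ₁ - χ₂)
    linarith
  obtain ⟨hl, hr⟩ := abs_le.mp hle
  set S := √((1 + 4 * χ₁ ^ 2) * (1 + 4 * χ₂ ^ 2))
  have hσ2 : σ ^ 2 = 1 := by rcases hσ with ⟨rfl, -⟩ | ⟨rfl, -⟩ <;> norm_num
  -- The witness is the factor of the other root, times `σ`; the bound above and the range of `τ`
  -- make it positive.
  refine ⟨σ * τ - σ * ((1 + 4 * χ₁ * χ₂ - σ * S) / 2), ?_, ?_⟩
  · rcases hσ with ⟨rfl, hτ⟩ | ⟨rfl, hτ⟩ <;> linarith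
  · simp only [traceParam, detParam]
    linear_combination (S ^ 2 / 4 * (σ ^ 2 + 1) - (τ - (1 + 4 * χ₁ * χ₂) / 2) ^ 2) * hσ2 + hS / 4

theorem isLineFrame_rep (hh : IsHermitianPPM h) {p q : ℙ ℂ V} (hp : ¬ IsIsotropic h p)
    (hq : ¬ IsIsotropic h q) (hne : p ≠ q) (horth : ¬ AreOrthogonal h p q)
    (hL : ¬ IsEuclideanLine h (line p q)) :
    ∃ n, IsLineFrame h p.rep q.rep n (normSq h p) (normSq h q) (tance h p q) := by
  have ha : h p.rep p.rep = normSq h p := (hh.coe_re _).symm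
  have hb : h q.rep q.rep = normSq h q := (hh.coe_re _).symm
  have ha0 : (normSq h p : ℂ) ≠ 0 := by exact_mod_cast hp
  have hb0 : (normSq h q : ℂ) ≠ 0 := by exact_mod_cast hq
  have hτ := coe_tance hh p q
  rw [ha, hb] at hτ
  have hc : h p.rep q.rep * h q.rep p.rep = tance h p q * normSq h p * normSq h q := by
    rw [hτ]
    field_simp
  refine exists_isLineFrame hh ha hb hp hq hc ?_ ?_
  · intro h0
    rw [h0, Complex.ofReal_zero, zero_mul, zero_mul] at hc
    rcases mul_eq_zero.mp hc with h1 | h1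
    · exact horth h1
    · exact horth (hh.eq_zero_symm h1)
  · intro h1
    rw [h1] at hc
    apply hL
    rw [line_eq_span]
    exact isEuclideanLine_of_tance_eq_one hh (linearIndependent_rep hne) ha hb hp hc

theorem IsLineFrame.isHyperbolicLine_iff {p q : ℙ ℂ V} {n : V} (hne : p ≠ q)
    (F : IsLineFrame h p.rep q.rep n (normSq h p) (normSq h q) (tance h p q)) :
    IsHyperbolicLine h (line p q) ↔ normSq h p * normSq h q * (1 - tance h p q) < 0 := by
  rw [line_eq_span]
  constructor
  · intro hW
    exact lt_of_le_of_ne (gram_nonpos_of_isHyperbolicLine F.self_left F.self_right F.mul_eq hW)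
      (mul_ne_zero (mul_ne_zero F.left_ne F.right_ne) (sub_ne_zero.mpr F.tance_ne_one.symm))
  · exact isHyperbolicLine_of_gram_neg F.hermitian (linearIndependent_rep hne) F.self_left
      F.self_right F.left_ne F.mul_eq

/-- The tance has the sign of `ab`, and for `ab > 0` the negative Gram determinant pushes it beyond
`1`. -/
theorem IsLineFrame.signature_cases {p q : ℙ ℂ V} {n : V}
    (F : IsLineFrame h p.rep q.rep n (normSq h p) (normSq h q) (tance h p q))
    (hneg : normSq h p * normSq h q * (1 - tance h p q) < 0) :
    signature h p * signature h q = 1 ∧ 1 < tance h p q ∨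
      signature h p * signature h q = -1 ∧ tance h p q < 0 := by
  have hpos := F.tance_mul_pos
  have hs : signature h p * signature h q = Real.sign (normSq h p * normSq h q) := by
    simp only [signature]
    rcases F.left_ne.lt_or_gt with ha | ha <;> rcases F.right_ne.lt_or_gt with hb | hb
    · simp [Real.sign_of_neg, ha, hb, Real.sign_of_pos (mul_pos_of_neg_of_neg ha hb)]
    · simp [Real.sign_of_neg, Real.sign_of_pos, ha, hb,
        Real.sign_of_neg (mul_neg_of_neg_of_pos ha hb)]
    · simp [Real.sign_of_neg, Real.sign_of_pos, ha, hb,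
        Real.sign_of_neg (mul_neg_of_pos_of_neg ha hb)]
    · simp [Real.sign_of_pos, ha, hb]
  rw [hs]
  rcases (mul_ne_zero F.left_ne F.right_ne).lt_or_gt with hab | hab
  · exact Or.inr ⟨Real.sign_of_neg hab, (neg_iff_neg_of_mul_pos hpos).mpr hab⟩
  · refine Or.inl ⟨Real.sign_of_pos hab, ?_⟩
    have := (pos_iff_neg_of_mul_neg hneg).mp hab
    linarith

end Classification

end ComplexHyperbolic

/-! ### The classification theorem -/

open ComplexHyperbolic in
theorem mainTheorem7 {V : Type*} [AddCommGroup V] [Module ℂ V]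
    (h : V →ₗ[ℂ] V →ₗ⋆[ℂ] ℂ) (hh : IsHermitianPPM h)
    (α₁ α₂ : ℂ) (hα₁ : ‖α₁‖ = 1) (hα₁' : α₁ ^ 3 ≠ 1) (hα₂ : ‖α₂‖ = 1) (hα₂' : α₂ ^ 3 ≠ 1)
    (p₁ p₂ : ℙ ℂ V) (hp₁ : ¬ IsIsotropic h p₁) (hp₂ : ¬ IsIsotropic h p₂)
    (hne : p₁ ≠ p₂) (horth : ¬ AreOrthogonal h p₁ p₂)
    (hL : ¬ IsEuclideanLine h (line p₁ p₂)) :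
    (IsRegularElliptic h (specialElliptic h p₂ α₂ * specialElliptic h p₁ α₁) ↔
      (0 < tance h p₁ p₂ ∧ tance h p₁ p₂ < 1) ∨
      (IsHyperbolicLine h (line p₁ p₂) ∧
        signature h p₁ * signature h p₂ * tance h p₁ p₂ <
          signature h p₁ * signature h p₂ *
            kOne α₁ α₂ (signature h p₁) (signature h p₂))) ∧
    (IsElliptoParabolic h (specialElliptic h p₂ α₂ * specialElliptic h p₁ α₁) ↔
      IsHyperbolicLine h (line p₁ p₂) ∧
        tance h p₁ p₂ = kOne α₁ α₂ (signature h p₁) (signature h p₂)) ∧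
    (IsLoxodromic h (specialElliptic h p₂ α₂ * specialElliptic h p₁ α₁) ↔
      IsHyperbolicLine h (line p₁ p₂) ∧
        signature h p₁ * signature h p₂ * tance h p₁ p₂ >
          signature h p₁ * signature h p₂ *
            kOne α₁ α₂ (signature h p₁) (signature h p₂)) := by
  obtain ⟨hb₁, -⟩ := unitRatio_chi hα₁ hα₁'
  obtain ⟨hb₂, -⟩ := unitRatio_chi hα₂ hα₂'
  obtain ⟨n, F⟩ := isLineFrame_rep hh hp₁ hp₂ hne horth hL
  have hprod : specialElliptic h p₂ α₂ * specialElliptic h p₁ α₁ =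
      ((α₂⁻¹ ^ 2 - α₂) * (α₁⁻¹ ^ 2 - α₁)) •
        normalizedProd h p₁.rep p₂.rep (chi α₁) (chi α₂) := by
    rw [specialElliptic_eq_smul p₁ hα₁ hα₁', specialElliptic_eq_smul p₂ hα₂ hα₂',
      smul_mul_smul_comm, normalizedProd]
  have hκ := mul_ne_zero hb₂ hb₁
  rw [hprod, F.isHyperbolicLine_iff hne]
  have hRE := F.isRegularElliptic (χ₁ := chi α₁) (χ₂ := chi α₂) hκ
  have hEP := F.isElliptoParabolic (χ₁ := chi α₁) (χ₂ := chi α₂) hκ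
  have hLox := F.isLoxodromic (χ₁ := chi α₁) (χ₂ := chi α₂) hκ
  have hpos := F.tance_mul_pos
  have hdiscr := neg_discr_eq (chi α₁) (chi α₂) (tance h p₁ p₂)
  have hfac := exists_discr_factor (χ₁ := chi α₁) (χ₂ := chi α₂) (τ := tance h p₁ p₂)
    (σ := signature h p₁ * signature h p₂)
  have hsig := F.signature_cases
  set I := ((α₂⁻¹ ^ 2 - α₂) * (α₁⁻¹ ^ 2 - α₁)) •
    normalizedProd h p₁.rep p₂.rep (chi α₁) (chi α₂)
  set D := traceParam (chi α₁) (chi α₂) (tance h p₁ p₂) ^ 2 - 4 * detParam (chi α₁) (chi α₂)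
    with hDdef
  set τ := tance h p₁ p₂
  have hEPL : IsElliptoParabolic h I → ¬ IsLoxodromic h I := fun h1 h2 => by
    have := h1.1.2.symm.trans h2.2
    norm_num at this
  by_cases hneg : normSq h p₁ * normSq h p₂ * (1 - τ) < 0
  · have hτ : ¬ (0 < τ ∧ τ < 1) := by
      rcases hsig hneg with ⟨-, h1⟩ | ⟨-, h1⟩ <;> rintro ⟨h2, h3⟩ <;> linarith
    obtain ⟨c, hc, hD⟩ := hfac (hsig hneg)
    have hσ : signature h p₁ * signature h p₂ ≠ 0 := by
      rcases hsig hneg with ⟨h1, -⟩ | ⟨h1, -⟩ <;> rw [h1] <;> norm_num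
    have hk : (1 + 4 * chi α₁ * chi α₂ + signature h p₁ * signature h p₂ *
        √((1 + 4 * chi α₁ ^ 2) * (1 + 4 * chi α₂ ^ 2))) / 2 =
        kOne α₁ α₂ (signature h p₁) (signature h p₂) := rfl
    rw [hk] at hD
    generalize kOne α₁ α₂ (signature h p₁) (signature h p₂) = k at *
    generalize signature h p₁ * signature h p₂ = σ at *
    simp only [hτ, hneg, false_or, true_and]
    -- The three classes are mutually exclusive, so the forward implications proved for each sign of
    -- `D` yield all the equivalences.
    rcases lt_trichotomy (σ * τ) (σ * k) with hlt | heq | hgt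
    · have h1 := hRE (by rw [hD]; exact mul_neg_of_pos_of_neg hc (by linarith))
      refine ⟨iff_of_true h1 hlt, iff_of_false (fun h2 => h2.1.1 h1.1) ?_,
        iff_of_false (fun h2 => h2.1 h1.1) hlt.not_gt⟩
      rintro rfl
      exact lt_irrefl _ hlt
    · have h1 := hEP (by rw [hD, heq, sub_self, mul_zero]) hneg
      exact ⟨iff_of_false (fun h2 => h1.1.1 h2.1) heq.not_lt,
        iff_of_true h1 (mul_left_cancel₀ hσ heq), iff_of_false (hEPL h1) heq.not_gt⟩
    · have h1 := hLox (by rw [hD]; exact mul_pos hc (by linarith)) hneg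
      refine ⟨iff_of_false (fun h2 => h1.1 h2.1) hgt.not_gt,
        iff_of_false (fun h2 => hEPL h2 h1) ?_, iff_of_true h1 hgt⟩
      rintro rfl
      exact lt_irrefl _ hgt
  · have hgt : 0 < normSq h p₁ * normSq h p₂ * (1 - τ) := lt_of_le_of_ne (not_lt.mp hneg)
      (mul_ne_zero (mul_ne_zero F.left_ne F.right_ne) (sub_ne_zero.mpr F.tance_ne_one.symm)).symm
    -- Multiplying `τab > 0` by the positive Gram determinant leaves `τ(1 - τ)` times a square.
    have hττ : 0 < τ * (1 - τ) := by
      have := mul_pos hpos hgt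
      have h6 : 0 < τ * (1 - τ) * (normSq h p₁ * normSq h p₂) ^ 2 := by linarith
      exact (pos_iff_pos_of_mul_pos h6).mpr (sq_pos_of_ne_zero
        (mul_ne_zero F.left_ne F.right_ne))
    have hτ : 0 < τ ∧ τ < 1 := by
      rcases mul_pos_iff.mp hττ with ⟨h1, h2⟩ | ⟨h1, h2⟩
      · exact ⟨h1, by linarith⟩
      · linarith
    have h1 := hRE (by
      have := mul_pos hττ (one_add_four_sq_pos (chi α₂))
      have := sq_nonneg (chi α₁ - chi α₂ + 2 * τ * chi α₂)
      linarith)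
    simp only [hτ, hneg, true_or, false_and, and_self]
    exact ⟨iff_of_true h1 trivial, iff_of_false (fun h2 => h2.1.1 h1.1) id,
      iff_of_false (fun h2 => h2.1 h1.1) id⟩
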